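/- Let $p$ and $q$ be two distinct primes with $\gcd(p-1,q-1)=4$, and put $e=(p-1)(q-1)/4$. Let $g$ be a common primitive root modulo $p$ and modulo $q$, and let $h$ be an integer with $h\equiv g \pmod p$ and $h\equiv 1\pmod q$. For $0\le i<4$ let $$D_i=\{g^sh^i \bmod pq : s=0,1,\ldots,e-1\},$$ and let $P=\{p,2p,\ldots,(q-1)p\}$, $Q=\{q,2q,\ldots,(p-1)q\}$, $R=\{0\}$; these seven sets partition $\mathbb{Z}_{pq}$. Let $(e_u)_{u\ge 0}$ be the sequence over $\mathbb{Z}_4$ of period $pq$ given by $$e_u=\begin{cases}2, & u \bmod pq\in Q\cup R,\\ 0, & u\bmod pq\in P,\\ i, & u\bmod pq\in D_i,\ i=0,1,2,3.\end{cases}$$ The linear complexity $LC((s_u))$ over $\mathbb{Z}_4$ of a periodic sequence $(s_u)_{u\ge 0}$ over $\mathbb{Z}_4$ is the least $L\ge 0$ for which there are $c_1,\ldots,c_L\in\mathbb{Z}_4$ with $s_{u+L}+c_1s_{u+L-1}+\cdots+c_Ls_u=0$ for all $u\ge 0$. Then: - if $p\equiv 5\pmod 8$ and $q\equiv 5\pmod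 8$, then $LC((e_u))$ equals $p+(p-1)(q-1)$ or $p+(p-1)(q-1)-\frac{(p-1)(q-1)}{4}$; - if $p\equiv 1\pmod 8$ and $q\equiv 5\pmod 8$, then $LC((e_u))$ equals $p+q-1+(p-1)(q-1)$ or $p+q-1+(p-1)(q-1)-\frac{(p-1)(q-1)}{4}$; - if $p\equiv 5\pmod 8$ and $q\equiv 1\pmod 8$, then $LC((e_u))$ equals $1+(p-1)(q-1)$ or $1+(p-1)(q-1)-\frac{(p-1)(q-1)}{4}$. -/

import Mathlib

namespace QuaternarySequence

/-- The generalized cyclotomic class `D_i = {g ^ s * h ^ i mod pq : s = 0, 1, ..., e - 1}`,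
where `e = (p - 1) * (q - 1) / 4`. -/
def cyclotomicClass (p q : ℕ) (g h : ℤ) (i : ℕ) : Set (ZMod (p * q)) :=
  {x | ∃ s : ℕ, s < (p - 1) * (q - 1) / 4 ∧ x = (g : ZMod (p * q)) ^ s * (h : ZMod (p * q)) ^ i}

/-- The set `P = {p, 2p, ..., (q - 1)p}` of residue classes modulo `pq`. -/
def classP (p q : ℕ) : Set (ZMod (p * q)) :=
  {x | ∃ k : ℕ, 1 ≤ k ∧ k < q ∧ x = ((k * p : ℕ) : ZMod (p * q))}

/-- The set `Q = {q, 2q, ..., (p - 1)q}` of residue classes modulo `pq`. -/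
def classQ (p q : ℕ) : Set (ZMod (p * q)) :=
  {x | ∃ k : ℕ, 1 ≤ k ∧ k < p ∧ x = ((k * q : ℕ) : ZMod (p * q))}

open Classical in
/-- The quaternary sequence `e_u`: it is `2` if `u mod pq` lies in `Q ∪ {0}`, `0` if `u mod pq`
lies in `P`, and `i` if `u mod pq` lies in `D_i`, `i = 0, 1, 2, 3`. When `p`, `q`, `g`, `h` are as
in the theorem, `{0}`, `P`, `Q`, `D_0`, `D_1`, `D_2`, `D_3` partition the residues modulo `pq`, so
that the order of the tests does not matter and the last branch is `D_3`. -/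
noncomputable def seq (p q : ℕ) (g h : ℤ) (u : ℕ) : ZMod 4 :=
  if (u : ZMod (p * q)) ∈ classQ p q ∪ {0} then 2
  else if (u : ZMod (p * q)) ∈ classP p q then 0
  else if (u : ZMod (p * q)) ∈ cyclotomicClass p q g h 0 then 0
  else if (u : ZMod (p * q)) ∈ cyclotomicClass p q g h 1 then 1
  else if (u : ZMod (p * q)) ∈ cyclotomicClass p q g h 2 then 2
  else 3

/-- The linear complexity over `ℤ/4` of a sequence: the least order `L` of a linear recurrence
`s (u + L) + c₁ * s (u + L - 1) + ... + c_L * s u = 0` (`u ≥ 0`) with coefficients in `ℤ/4` that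
the sequence satisfies; Mathlib's recurrences have the lower terms on the right, so that
`coeffs i = -c_{L - i}`. The set is nonempty for every periodic sequence. -/
noncomputable def linearComplexity (s : ℕ → ZMod 4) : ℕ :=
  sInf {L : ℕ | ∃ E : LinearRecurrence (ZMod 4), E.order = L ∧ E.IsSolution s}

end QuaternarySequence

/-!
Over a Galois ring `R` of characteristic `4` that contains a root of unity `β` of order `N = pq`,
a sequence `s` over `ℤ/4` of period `N` has the Fourier coefficients `S j = ∑ x, s x * β ^ (j * x)`,
and its linear complexity is the number of `j` with `S j ≠ 0`
(`GaloisRing.linearComplexity_eq_card_spectrum`). On the one hand, if `f` is the characteristic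
polynomial of a recurrence for `s`, then `f (β ^ (-j)) * S j = 0`, so that `f` vanishes modulo the
maximal ideal at `β ^ (-j)` whenever `S j ≠ 0`. On the other hand, the product of the
`X - β ^ (-j)` over these `j` annihilates `s`, and it has coefficients in `ℤ/4` because the
Frobenius endomorphism of `R`, which maps `β` to `β ^ 2` and `S j` to `S (2 * j)`, fixes it. The
ring is taken to be the quotient of the Witt vectors of the algebraic closure of `𝔽₂` by `4`
(`nonempty_galoisRing_of_isPrimitiveRoot`).

The point of the computation of `S` is that the class of a unit `x` modulo `pq` is
`α x - γ x`, where `α` and `γ` are the discrete logarithms modulo `p` and modulo `q`, reduced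
modulo `4` (`natCast_mem_cyclotomicClass_iff`). By the Chinese remainder theorem the transform
becomes a double sum which splits into one-variable sums `A c = ∑ a, α a * η (c * a)` and
`B d = ∑ b, γ b * θ (d * b)` (`sum_pairSeq_mul_addChar`). Since `p = q = 1` in `R`, the coefficient
at `(c, d)` is

* `2` at `(0, 0)`;
* `2 - A 0` at `(0, d)` with `d ≠ 0`, where `A 0 = 2 * ((p - 1) / 4)`;
* `B 0 = 2 * ((q - 1) / 4)` at `(c, 0)` with `c ≠ 0`;
* `B d - A c = B 1 - A 1 - α c + γ d` if `c` and `d` are nonzero.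

In the last case the coefficients vanish for a quarter of the pairs `(c, d)` if `B 1 - A 1` lies in
`ℤ/4`, and for none otherwise; this is the alternative in the theorem. The residues of `p` and `q`
modulo `8` decide the other cases.
-/

namespace QuaternarySequence

/-! ### The Galois ring -/

/-- The features of a Galois ring of characteristic `4` that contains an `N`-th root of unity with
residue of exact order `N`: the ring `R`, local with residue field `k`, receives `ℤ/4`
injectively through `base`, and carries an injective endomorphism `frob` which squares the root of
unity and whose fixed points all come from `ℤ/4`. -/
structure GaloisRing (N : ℕ) (R k : Type*) [CommRing R] [Field k] where
  /-- The structure map from `ℤ/4`. -/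
  base : ZMod 4 →+* R
  /-- The reduction to the residue field. -/
  residue : R →+* k
  /-- The lift of the Frobenius endomorphism of the residue field. -/
  frob : R →+* R
  /-- The chosen `N`-th root of unity. -/
  root : R
  base_injective : Function.Injective base
  isUnit_of_residue_ne_zero : ∀ x, residue x ≠ 0 → IsUnit x
  frob_injective : Function.Injective frob
  exists_base_eq_of_frob_eq : ∀ x, frob x = x → ∃ c, base c = x
  frob_root : frob root = root ^ 2
  root_pow : root ^ N = 1
  residue_root : IsPrimitiveRoot (residue root) N

section WittVector

variable {k : Type*} [Field k] [CharP k 2]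

local notation "W" => WittVector 2 k

theorem witt_two_ne_zero : (2 : W) ≠ 0 := by
  simpa using WittVector.p_nonzero 2 k

variable [PerfectRing k 2]

theorem witt_dvd_two_iff (x : W) : 2 ∣ x ↔ x.coeff 0 = 0 := by
  have := WittVector.mem_span_p_iff_coeff_zero_eq_zero (p := 2) x
  rwa [Ideal.mem_span_singleton, Nat.cast_ofNat] at this

theorem witt_dvd_four_of_frobenius {x : W} (hx : 4 ∣ WittVector.frobenius x) : 4 ∣ x := by
  obtain ⟨y, hy⟩ := hx
  obtain ⟨z, rfl⟩ := (WittVector.frobenius_bijective 2 k).surjective y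
  refine ⟨z, (WittVector.frobenius_bijective 2 k).injective ?_⟩
  rw [hy, map_mul, map_ofNat]

/-- A Witt vector fixed by the Frobenius modulo `2` is congruent to `0` or `1` modulo `2`, since
its residue is a root of `X ^ 2 = X`. -/
theorem witt_exists_eq_natCast_add_two_mul {x : W} (hx : 2 ∣ WittVector.frobenius x - x) :
    ∃ (n : ℕ) (y : W), x = n + 2 * y := by
  have h : x.coeff 0 ^ 2 - x.coeff 0 = 0 := by
    have := (witt_dvd_two_iff _).1 hx
    rw [← WittVector.constantCoeff_apply, map_sub] at this
    simpa [WittVector.constantCoeff_apply, WittVector.coeff_frobenius_charP] using this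
  have h' : x.coeff 0 = 0 ∨ x.coeff 0 - 1 = 0 := by
    rw [← mul_eq_zero]; linear_combination h
  rcases h' with h' | h'
  · obtain ⟨y, hy⟩ := (witt_dvd_two_iff x).2 h'
    exact ⟨0, y, by simpa using hy⟩
  · obtain ⟨y, hy⟩ := (witt_dvd_two_iff (x - 1)).2 (by
      rw [← WittVector.constantCoeff_apply, map_sub]
      simpa [WittVector.constantCoeff_apply] using h')
    exact ⟨1, y, by rw [← hy]; push_cast; ring⟩

/-- A Witt vector fixed by the Frobenius modulo `4` is congruent to an integer modulo `4`: this is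
the previous statement applied to both binary digits. -/
theorem witt_exists_four_dvd_sub_natCast {x : W} (hx : 4 ∣ WittVector.frobenius x - x) :
    ∃ n : ℕ, 4 ∣ x - n := by
  obtain ⟨n, y, rfl⟩ := witt_exists_eq_natCast_add_two_mul (dvd_trans ⟨2, by norm_num⟩ hx)
  have hy : 2 ∣ WittVector.frobenius y - y := by
    obtain ⟨z, hz⟩ := hx
    refine ⟨z, mul_left_cancel₀ witt_two_ne_zero ?_⟩
    rw [map_add, map_mul, map_natCast, map_ofNat] at hz
    linear_combination hz
  obtain ⟨m, z, rfl⟩ := witt_exists_eq_natCast_add_two_mul hy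
  exact ⟨n + 2 * m, z, by push_cast; ring⟩

theorem ringHom_zmod_four_injective {R : Type*} [Ring R] (f : ZMod 4 →+* R) (h2 : (2 : R) ≠ 0) :
    Function.Injective f := by
  rw [injective_iff_map_eq_zero]
  intro x hx
  by_contra hx0
  have key : ∀ x : ZMod 4, x ≠ 0 → x * 1 = 2 ∨ x * 2 = 2 := by decide
  have hf : f 2 = 0 := by
    rcases key x hx0 with h | h <;> rw [← h, map_mul, hx, zero_mul]
  exact h2 ((map_ofNat f 2).symm.trans hf)

/-- The quotient of the Witt vectors of an perfect field of characteristic `2` by `4`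
is a Galois ring in the above sense; the root of unity is a Teichmüller representative. -/
theorem nonempty_galoisRing_of_isPrimitiveRoot {N : ℕ} {b : k} (hb : IsPrimitiveRoot b N) :
    Nonempty (GaloisRing N (W ⧸ Ideal.span {(4 : W)}) k) := by
  have mem (x : W) : Ideal.Quotient.mk (Ideal.span {(4 : W)}) x = 0 ↔ 4 ∣ x := by
    rw [Ideal.Quotient.eq_zero_iff_mem, Ideal.mem_span_singleton]
  have h4 : ((4 : ℕ) : W ⧸ Ideal.span {(4 : W)}) = 0 := by
    have := (mem 4).2 dvd_rfl
    rwa [map_ofNat] at this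
  have h4k : (4 : k) = 0 := by
    have := CharTwo.two_eq_zero (R := k)
    linear_combination 2 * this
  have res (x : W) (hx : x ∈ Ideal.span {(4 : W)}) : WittVector.constantCoeff x = 0 := by
    obtain ⟨y, rfl⟩ := Ideal.mem_span_singleton.1 hx
    rw [map_mul, map_ofNat, h4k, zero_mul]
  have fr : Ideal.span {(4 : W)} ≤ (Ideal.span {(4 : W)}).comap WittVector.frobenius := by
    intro x hx
    obtain ⟨y, rfl⟩ := Ideal.mem_span_singleton.1 hx
    rw [Ideal.mem_comap, Ideal.mem_span_singleton, map_mul, map_ofNat]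
    exact dvd_mul_right _ _
  have : CharP (W ⧸ Ideal.span {(4 : W)}) (ringChar (W ⧸ Ideal.span {(4 : W)})) :=
    ringChar.charP _
  refine ⟨{
    base := ZMod.castHom ((ringChar.spec _ _).1 h4) _
    residue := Ideal.Quotient.lift _ WittVector.constantCoeff res
    frob := Ideal.quotientMap _ WittVector.frobenius fr
    root := Ideal.Quotient.mk _ (WittVector.teichmuller 2 b)
    base_injective := ?_
    isUnit_of_residue_ne_zero := ?_
    frob_injective := ?_
    exists_base_eq_of_frob_eq := ?_
    frob_root := ?_
    root_pow := ?_
    residue_root := ?_ }⟩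
  · refine ringHom_zmod_four_injective _ fun h2 => ?_
    obtain ⟨y, hy⟩ := (mem 2).1 (by rwa [map_ofNat])
    have hy' : (1 : W) = 2 * y := mul_left_cancel₀ witt_two_ne_zero (by linear_combination hy)
    simpa using (witt_dvd_two_iff (1 : W)).1 ⟨y, hy'⟩
  · intro x hx
    obtain ⟨x, rfl⟩ := Ideal.Quotient.mk_surjective x
    exact (WittVector.isUnit_of_coeff_zero_ne_zero x hx).map _
  · rw [injective_iff_map_eq_zero]
    intro x hx
    obtain ⟨x, rfl⟩ := Ideal.Quotient.mk_surjective x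
    rw [Ideal.quotientMap_mk, mem] at hx
    exact (mem x).2 (witt_dvd_four_of_frobenius hx)
  · intro x hx
    obtain ⟨x, rfl⟩ := Ideal.Quotient.mk_surjective x
    rw [Ideal.quotientMap_mk, ← sub_eq_zero, ← map_sub, mem] at hx
    obtain ⟨n, hn⟩ := witt_exists_four_dvd_sub_natCast hx
    refine ⟨n, ?_⟩
    rw [← mem, map_sub, sub_eq_zero, map_natCast] at hn
    rw [map_natCast, hn]
  · rw [Ideal.quotientMap_mk, ← map_pow, ← map_pow, WittVector.frobenius_eq_map_frobenius,
      WittVector.map_teichmuller, frobenius_def]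
  · rw [← map_pow, ← map_pow, hb.pow_eq_one, map_one, map_one]
  · rwa [Ideal.Quotient.lift_mk, WittVector.constantCoeff_apply, WittVector.teichmuller_coeff_zero]

end WittVector

/-- For odd `N` the algebraic closure of `𝔽₂` contains a primitive `N`-th root of unity. -/
theorem exists_galoisRing {N : ℕ} (hN : Odd N) :
    ∃ (R k : Type) (_ : CommRing R) (_ : Field k), Nonempty (GaloisRing N R k) := by
  have : NeZero (N : AlgebraicClosure (ZMod 2)) := ⟨by
    rw [Ne, CharP.cast_eq_zero_iff _ 2]
    exact hN.not_two_dvd_nat⟩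
  have : NeZero N := NeZero.of_neZero_natCast (AlgebraicClosure (ZMod 2))
  obtain ⟨b, hb⟩ :=
    HasEnoughRootsOfUnity.exists_primitiveRoot (AlgebraicClosure (ZMod 2)) N
  exact ⟨_, _, _, _, nonempty_galoisRing_of_isPrimitiveRoot hb⟩

/-! ### Linear complexity and the discrete Fourier transform -/

/-- Orthogonality of characters over a ring that need not be a domain: the values of the character
have to differ from `1` by units. -/
theorem sum_addChar_mul {N : ℕ} [NeZero N] {R : Type*} [CommRing R] {η : AddChar (ZMod N) R}
    (hη : ∀ x, x ≠ 0 → IsUnit (η x - 1)) (x : ZMod N) :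
    ∑ j, η (x * j) = if x = 0 then (N : R) else 0 := by
  split_ifs with hx
  · simp [hx, ZMod.card]
  · have h : η x * ∑ j, η (x * j) = ∑ j, η (x * j) := by
      rw [Finset.mul_sum]
      refine Fintype.sum_equiv (Equiv.addLeft 1) _ _ fun j => ?_
      rw [← AddChar.map_add_eq_mul, Equiv.coe_addLeft]
      ring_nf
    refine (hη x hx).mul_right_eq_zero.1 ?_
    linear_combination h

section Fourier

variable {N : ℕ} {R k : Type*} [CommRing R] [Field k]

open Polynomial

namespace GaloisRing

variable (D : GaloisRing N R k)

theorem frob_base (c : ZMod 4) : D.frob (D.base c) = D.base c :=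
  RingHom.congr_fun (RingHom.ext_zmod (D.frob.comp D.base) D.base) c

variable [NeZero N]

/-- The additive character of `ℤ/N` that sends `1` to the root of unity. -/
def char : AddChar (ZMod N) R := AddChar.zmodChar N D.root_pow

/-- The discrete Fourier transform of an `N`-periodic sequence over `ℤ/4`. -/
def dft (s : ZMod N → ZMod 4) (j : ZMod N) : R := ∑ x, D.base (s x) * D.char (j * x)

theorem residue_char_injective : Function.Injective fun x => D.residue (D.char x) := by
  intro x y hxy
  simp only [char, AddChar.zmodChar_apply, map_pow] at hxy
  exact ZMod.val_injective N (D.residue_root.pow_inj (ZMod.val_lt x) (ZMod.val_lt y) hxy)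

theorem isUnit_char_sub_one {x : ZMod N} (hx : x ≠ 0) : IsUnit (D.char x - 1) := by
  refine D.isUnit_of_residue_ne_zero _ fun h => hx (D.residue_char_injective ?_)
  simpa [sub_eq_zero] using h

theorem frob_char (x : ZMod N) : D.frob (D.char x) = D.char (2 * x) := by
  rw [two_mul, AddChar.map_add_eq_mul, char, AddChar.zmodChar_apply, map_pow, D.frob_root]
  ring

/-- Fourier inversion. -/
theorem sum_dft_mul_char (s : ZMod N → ZMod 4) (y : ZMod N) :
    ∑ j, D.dft s j * D.char (-(j * y)) = N * D.base (s y) := by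
  simp only [dft, Finset.sum_mul]
  rw [Finset.sum_comm]
  have h (x : ZMod N) : ∑ j, D.base (s x) * D.char (j * x) * D.char (-(j * y)) =
      if x = y then N * D.base (s y) else 0 := by
    simp only [mul_assoc, ← AddChar.map_add_eq_mul, ← sub_eq_add_neg, ← mul_sub]
    simp only [← Finset.mul_sum, mul_comm _ (x - y)]
    rw [sum_addChar_mul fun _ => D.isUnit_char_sub_one]
    simp only [sub_eq_zero]
    split_ifs with hxy
    · rw [hxy, mul_comm]
    · rw [mul_zero]
  simp [h]

theorem sum_base_shift_mul_char (s : ZMod N → ZMod 4) (j y : ZMod N) :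
    ∑ x, D.base (s (x + y)) * D.char (j * x) = D.char (-(j * y)) * D.dft s j := by
  rw [dft, Finset.mul_sum]
  refine Fintype.sum_equiv (Equiv.addRight y) _ _ fun x => ?_
  rw [Equiv.coe_addRight, mul_left_comm, ← AddChar.map_add_eq_mul]
  ring_nf

theorem frob_dft (s : ZMod N → ZMod 4) (j : ZMod N) : D.frob (D.dft s j) = D.dft s (2 * j) := by
  simp only [dft, map_sum, map_mul, frob_base, frob_char, mul_assoc]

theorem char_neg_mul_natCast (j : ZMod N) (n : ℕ) : D.char (-(j * n)) = D.char (-j) ^ n := by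
  rw [← AddChar.map_nsmul_eq_pow, nsmul_eq_mul]
  ring_nf

open Classical in
/-- The frequencies at which the transform of `s` does not vanish. -/
noncomputable def spectrum (s : ZMod N → ZMod 4) : Finset (ZMod N) :=
  Finset.univ.filter fun j => D.dft s j ≠ 0

theorem mem_spectrum {s : ZMod N → ZMod 4} {j : ZMod N} :
    j ∈ D.spectrum s ↔ D.dft s j ≠ 0 := by
  simp [spectrum]

/-- The residue of the characteristic polynomial of a recurrence satisfied by `s` vanishes at the
distinct points given by the spectrum of `s`: at such a frequency the value of the characteristic
polynomial annihilates a nonzero element, so that it is not a unit. -/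
theorem card_spectrum_le_order {s : ZMod N → ZMod 4} {E : LinearRecurrence (ZMod 4)}
    (hE : E.IsSolution fun u => s u) : (D.spectrum s).card ≤ E.order := by
  classical
  have : Fact (1 < 4) := ⟨by norm_num⟩
  have hroot (j : ZMod N) : E.charPoly.eval₂ D.base (D.char (-j)) * D.dft s j = 0 := by
    have hs (x : ZMod N) : s (x + E.order) = ∑ i, E.coeffs i * s (x + (i : ℕ)) := by
      simpa using hE x.val
    have h := D.sum_base_shift_mul_char s j E.order
    simp only [hs, map_sum, map_mul, Finset.sum_mul] at h
    rw [Finset.sum_comm] at h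
    simp only [mul_assoc, ← Finset.mul_sum, D.sum_base_shift_mul_char,
      D.char_neg_mul_natCast] at h
    rw [LinearRecurrence.charPoly, eval₂_sub, eval₂_finsetSum, sub_mul, Finset.sum_mul]
    simp only [eval₂_monomial, map_one, one_mul, mul_assoc]
    rw [h, sub_self]
  set f := E.charPoly.map (D.residue.comp D.base)
  have hf : f.Monic := E.charPoly_monic.map _
  have hdeg : f.natDegree = E.order := by
    rw [E.charPoly_monic.natDegree_map]
    exact natDegree_eq_of_degree_eq_some E.charPoly_degree_eq_order
  have hsub : (D.spectrum s).image (fun j => D.residue (D.char (-j))) ⊆ f.roots.toFinset := by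
    intro y hy
    obtain ⟨j, hj, rfl⟩ := Finset.mem_image.1 hy
    rw [Multiset.mem_toFinset, mem_roots hf.ne_zero, IsRoot.def, eval_map, ← hom_eval₂]
    by_contra hne
    exact D.mem_spectrum.1 hj ((D.isUnit_of_residue_ne_zero _ hne).mul_right_eq_zero.1 (hroot j))
  rw [← Finset.card_image_of_injective _
    (D.residue_char_injective.comp neg_injective : Function.Injective fun j => _), ← hdeg]
  exact (Finset.card_le_card hsub).trans ((Multiset.toFinset_card_le _).trans (card_roots' f))

/-- The monic polynomial whose roots are the values of the character at the negated spectrum. -/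
noncomputable def spectrumPoly (s : ZMod N → ZMod 4) : R[X] :=
  ∏ j ∈ D.spectrum s, (X - C (D.char (-j)))

theorem spectrumPoly_map_frob (hN : Odd N) (s : ZMod N → ZMod 4) :
    (D.spectrumPoly s).map D.frob = D.spectrumPoly s := by
  obtain ⟨u, hu⟩ : IsUnit (2 : ZMod N) := by
    have := (ZMod.isUnit_iff_coprime 2 N).2 (Nat.coprime_two_left.2 hN)
    rwa [Nat.cast_ofNat] at this
  rw [spectrumPoly, Polynomial.map_prod]
  refine Finset.prod_equiv u.mulLeft (fun j => ?_) fun j _ => ?_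
  · rw [Units.mulLeft_apply, hu, D.mem_spectrum, D.mem_spectrum, ← D.frob_dft,
      map_ne_zero_iff _ D.frob_injective]
  · rw [Units.mulLeft_apply, hu, Polynomial.map_sub, map_X, map_C, D.frob_char, mul_neg]

/-- The spectrum is stable under doubling, which the Frobenius induces; hence the polynomial with
the negated spectrum as its roots has coefficients in `ℤ/4`, and it annihilates `s` by Fourier
inversion. -/
theorem exists_order_eq_card_spectrum (hN : Odd N) (s : ZMod N → ZMod 4) :
    ∃ E : LinearRecurrence (ZMod 4), E.order = (D.spectrum s).card ∧
      E.IsSolution fun u => s u := by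
  set F := D.spectrumPoly s with hF
  have hmonic : F.Monic := monic_prod_of_monic _ _ fun j _ => monic_X_sub_C _
  have : Fact (1 < 4) := ⟨by norm_num⟩
  have : Nontrivial R := D.base_injective.nontrivial
  have hdeg : F.natDegree = (D.spectrum s).card := by
    rw [hF, spectrumPoly, natDegree_prod_of_monic _ _ fun j _ => monic_X_sub_C _]
    simp
  have hcoeff (n : ℕ) : ∃ c, D.base c = F.coeff n := by
    refine D.exists_base_eq_of_frob_eq _ ?_
    rw [← coeff_map, hF, D.spectrumPoly_map_frob hN]
  choose c hc using hcoeff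
  refine ⟨⟨(D.spectrum s).card, fun i => -c i⟩, rfl, fun n => D.base_injective ?_⟩
  -- `2 ^ 2 = 0` in the residue field, so that the odd number `N` is `1` there
  have hNunit : IsUnit (N : R) := by
    refine D.isUnit_of_residue_ne_zero _ ?_
    rw [map_natCast]
    have h4 : (4 : k) = 0 := by
      have := congrArg (D.residue.comp D.base) (show (4 : ZMod 4) = 0 by decide)
      rwa [map_ofNat, map_zero] at this
    have h2 : (2 : k) = 0 := by
      have : (2 : k) * 2 = 0 := by rw [← h4]; norm_num
      exact mul_self_eq_zero.1 this
    obtain ⟨m, rfl⟩ := hN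
    simp [h2]
  have hzero (j : ZMod N) : D.dft s j * F.eval (D.char (-j)) = 0 := by
    by_cases hj : D.dft s j = 0
    · rw [hj, zero_mul]
    · rw [hF, spectrumPoly, eval_prod, Finset.prod_eq_zero (D.mem_spectrum.2 hj) (by simp),
        mul_zero]
  have hann : ∑ i ∈ Finset.range (F.natDegree + 1), F.coeff i * D.base (s ((n + i : ℕ))) = 0 := by
    refine hNunit.mul_right_eq_zero.1 ?_
    calc (N : R) * ∑ i ∈ Finset.range (F.natDegree + 1), F.coeff i * D.base (s ((n + i : ℕ)))
        = ∑ i ∈ Finset.range (F.natDegree + 1), ∑ j,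
            F.coeff i * (D.dft s j * D.char (-(j * (n + i : ℕ)))) := by
          rw [Finset.mul_sum]
          refine Finset.sum_congr rfl fun i _ => ?_
          rw [← Finset.mul_sum, D.sum_dft_mul_char]
          ring
      _ = ∑ j, D.char (-j) ^ n * (D.dft s j * F.eval (D.char (-j))) := by
          rw [Finset.sum_comm]
          refine Finset.sum_congr rfl fun j _ => ?_
          rw [eval_eq_sum_range, Finset.mul_sum, Finset.mul_sum]
          refine Finset.sum_congr rfl fun i _ => ?_
          rw [D.char_neg_mul_natCast, pow_add]
          ring
      _ = 0 := by simp [hzero]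
  rw [Finset.sum_range_succ, hmonic.coeff_natDegree, one_mul, hdeg, ← Fin.sum_univ_eq_sum_range
    (fun i => F.coeff i * D.base (s ((n + i : ℕ))))] at hann
  simp only [map_sum, map_mul, map_neg, hc, neg_mul, Finset.sum_neg_distrib]
  linear_combination hann

/-- The linear complexity of a sequence over `ℤ/4` of odd period `N` is the number of nonzero
values of its Fourier transform in a Galois ring. -/
theorem linearComplexity_eq_card_spectrum (hN : Odd N) (s : ZMod N → ZMod 4) :
    linearComplexity (fun u => s u) = (D.spectrum s).card := by
  refine le_antisymm (Nat.sInf_le (D.exists_order_eq_card_spectrum hN s)) ?_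
  refine le_csInf ⟨_, D.exists_order_eq_card_spectrum hN s⟩ ?_
  rintro _ ⟨E, rfl, hE⟩
  exact D.card_spectrum_le_order hE

end GaloisRing

end Fourier

/-! ### Discrete logarithms modulo four -/

/-- `α` is the discrete logarithm to the base `g` on `ℤ/p`, reduced modulo `4` and extended by
`0` to the residue `0`. -/
structure IsQuarticLog {p : ℕ} (g : ZMod p) (α : ZMod p → ZMod 4) : Prop where
  map_zero : α 0 = 0
  map_pow : ∀ n : ℕ, α (g ^ n) = n

section QuarticLog

variable {p : ℕ} [Fact p.Prime] {g : ZMod p}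

theorem exists_pow_eq_of_isPrimitiveRoot (hg : IsPrimitiveRoot g (p - 1)) {a : ZMod p}
    (ha : a ≠ 0) : ∃ n < p - 1, g ^ n = a := by
  have : NeZero (p - 1) := ⟨Nat.sub_ne_zero_of_lt (Fact.out : p.Prime).one_lt⟩
  exact hg.eq_pow_of_pow_eq_one (ZMod.pow_card_sub_one_eq_one ha)

theorem pow_eq_pow_iff_of_isPrimitiveRoot (hg : IsPrimitiveRoot g (p - 1)) {m n : ℕ} :
    g ^ m = g ^ n ↔ m ≡ n [MOD p - 1] := by
  obtain ⟨u, rfl⟩ := hg.isUnit (Nat.sub_ne_zero_of_lt (Fact.out : p.Prime).one_lt)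
  rw [hg.eq_orderOf, orderOf_units, ← pow_eq_pow_iff_modEq]
  norm_cast

theorem exists_isQuarticLog (hp4 : 4 ∣ p - 1) (hg : IsPrimitiveRoot g (p - 1)) :
    ∃ α, IsQuarticLog g α := by
  classical
  have hg0 : g ≠ 0 := hg.ne_zero (Nat.sub_ne_zero_of_lt (Fact.out : p.Prime).one_lt)
  refine ⟨fun a => if h : ∃ n : ℕ, g ^ n = a then (h.choose : ZMod 4) else 0, ?_, fun n => ?_⟩
  · rw [dif_neg]
    rintro ⟨n, hn⟩
    exact pow_ne_zero n hg0 hn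
  · have h : ∃ m : ℕ, g ^ m = g ^ n := ⟨n, rfl⟩
    rw [dif_pos h, ZMod.natCast_eq_natCast_iff]
    exact ((pow_eq_pow_iff_of_isPrimitiveRoot hg).1 h.choose_spec).of_dvd hp4

namespace IsQuarticLog

variable {α : ZMod p → ZMod 4}

theorem map_mul (hα : IsQuarticLog g α) (hg : IsPrimitiveRoot g (p - 1)) {a b : ZMod p}
    (ha : a ≠ 0) (hb : b ≠ 0) : α (a * b) = α a + α b := by
  obtain ⟨m, -, rfl⟩ := exists_pow_eq_of_isPrimitiveRoot hg ha
  obtain ⟨n, -, rfl⟩ := exists_pow_eq_of_isPrimitiveRoot hg hb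
  rw [← pow_add, hα.map_pow, hα.map_pow, hα.map_pow, Nat.cast_add]

/-- The logarithm takes each value modulo `4` equally often on the nonzero residues. -/
theorem sum_comp (hα : IsQuarticLog g α) (hp4 : 4 ∣ p - 1) (hg : IsPrimitiveRoot g (p - 1))
    {M : Type*} [AddCommMonoid M] (f : ZMod 4 → M) :
    ∑ a ∈ Finset.univ.erase 0, f (α a) = ((p - 1) / 4) • ∑ m, f m := by
  have hg0 : g ≠ 0 := hg.ne_zero (Nat.sub_ne_zero_of_lt (Fact.out : p.Prime).one_lt)
  have key (t : ℕ) : ∑ n ∈ Finset.range (4 * t), f (n : ZMod 4) = t • ∑ m, f m := by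
    have h4 : ((4 : ℕ) : ZMod 4) = 0 := by decide
    have hsum : ∑ n ∈ Finset.range 4, f (n : ZMod 4) = ∑ m, f m := by
      rw [← Fin.sum_univ_eq_sum_range fun n => f (n : ZMod 4)]
      exact Finset.sum_congr rfl fun m _ => congrArg f (ZMod.natCast_zmod_val (n := 4) m)
    induction t with
    | zero => simp
    | succ t ih =>
      rw [Nat.mul_succ, Finset.sum_range_add, ih, succ_nsmul]
      simp only [Nat.cast_add, Nat.cast_mul, h4, zero_mul, zero_add, hsum]
  rw [← key, Nat.mul_div_cancel' hp4]
  symm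
  refine Finset.sum_bij (fun n _ => g ^ n) (fun n _ => by simp [hg0]) ?_ ?_ ?_
  · intro m hm n hn h
    exact hg.pow_inj (Finset.mem_range.1 hm) (Finset.mem_range.1 hn) h
  · intro a ha
    obtain ⟨n, hn, rfl⟩ := exists_pow_eq_of_isPrimitiveRoot hg (Finset.ne_of_mem_erase ha)
    exact ⟨n, Finset.mem_range.2 hn, rfl⟩
  · intro n _
    rw [hα.map_pow]

end IsQuarticLog

end QuarticLog

/-! ### The sequence on pairs of residues -/

/-- The quaternary sequence as a function of the residues `a` modulo `p` and `b` modulo `q`: off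
the multiples of `p` and of `q` it is a difference of two discrete logarithms. -/
def pairSeq {p q : ℕ} (α : ZMod p → ZMod 4) (γ : ZMod q → ZMod 4) (a : ZMod p) (b : ZMod q) :
    ZMod 4 :=
  if b = 0 then 2 else if a = 0 then 0 else α a - γ b

theorem exists_lt_eq_mul_iff_dvd {N m n : ℕ} (hm : 0 < m) (hN : N = m * n) (u : ℕ) :
    (∃ k < m, (u : ZMod N) = ((k * n : ℕ) : ZMod N)) ↔ n ∣ u := by
  constructor
  · rintro ⟨k, -, hk⟩
    rw [ZMod.natCast_eq_natCast_iff] at hk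
    exact (hk.dvd_iff (hN ▸ dvd_mul_left n m)).2 (dvd_mul_left n k)
  · rintro ⟨v, rfl⟩
    refine ⟨v % m, Nat.mod_lt _ hm, ?_⟩
    rw [ZMod.natCast_eq_natCast_iff, hN, mul_comm n v]
    exact ((Nat.mod_modEq v m).symm).mul_right' n

theorem natCast_mem_classQ_union_zero_iff {p q : ℕ} (hp : 0 < p) (u : ℕ) :
    (u : ZMod (p * q)) ∈ classQ p q ∪ {0} ↔ q ∣ u := by
  rw [← exists_lt_eq_mul_iff_dvd hp rfl]
  constructor
  · rintro (⟨k, -, hk, h⟩ | h)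
    · exact ⟨k, hk, h⟩
    · exact ⟨0, hp, by simpa using h⟩
  · rintro ⟨k, hk, h⟩
    rcases Nat.eq_zero_or_pos k with rfl | h0
    · exact Or.inr (by simpa using h)
    · exact Or.inl ⟨k, h0, hk, h⟩

theorem natCast_mem_classP_iff {p q : ℕ} (hq : 0 < q) {u : ℕ} (hu : ¬ q ∣ u) :
    (u : ZMod (p * q)) ∈ classP p q ↔ p ∣ u := by
  rw [← exists_lt_eq_mul_iff_dvd hq (mul_comm p q)]
  constructor
  · rintro ⟨k, -, hk, h⟩
    exact ⟨k, hk, h⟩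
  · rintro ⟨k, hk, h⟩
    refine ⟨k, Nat.pos_of_ne_zero ?_, hk, h⟩
    rintro rfl
    rw [zero_mul, ZMod.natCast_eq_natCast_iff] at h
    exact hu (((h.dvd_iff (dvd_mul_left q p)).2 (dvd_zero q)))

section Sequence

variable {p q : ℕ} [Fact p.Prime] [Fact q.Prime] {g h : ℤ} {α : ZMod p → ZMod 4}
  {γ : ZMod q → ZMod 4}

/-- The class of a unit is the difference of its two discrete logarithms modulo `4`: exponents
modulo `p - 1` and `q - 1` can be prescribed simultaneously as soon as they agree modulo
`gcd (p - 1) (q - 1) = 4`. -/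
theorem natCast_mem_cyclotomicClass_iff (hpq : p ≠ q) (hgcd : Nat.gcd (p - 1) (q - 1) = 4)
    (hgp : IsPrimitiveRoot (g : ZMod p) (p - 1)) (hgq : IsPrimitiveRoot (g : ZMod q) (q - 1))
    (hhp : h ≡ g [ZMOD p]) (hhq : h ≡ 1 [ZMOD q])
    (hα : IsQuarticLog (g : ZMod p) α) (hγ : IsQuarticLog (g : ZMod q) γ) {u : ℕ}
    (hup : (u : ZMod p) ≠ 0) (huq : (u : ZMod q) ≠ 0) {i : ℕ} (hi : i < 4) :
    (u : ZMod (p * q)) ∈ cyclotomicClass p q g h i ↔ α u - γ u = i := by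
  have hhp' : (h : ZMod p) = g := (ZMod.intCast_eq_intCast_iff _ _ _).2 hhp
  have hhq' : (h : ZMod q) = 1 := by simpa using (ZMod.intCast_eq_intCast_iff _ _ _).2 hhq
  have hcop : p.Coprime q := (Nat.coprime_primes Fact.out Fact.out).2 hpq
  have split (s : ℕ) : (u : ZMod (p * q)) = (g : ZMod (p * q)) ^ s * (h : ZMod (p * q)) ^ i ↔
      (u : ZMod p) = (g : ZMod p) ^ (s + i) ∧ (u : ZMod q) = (g : ZMod q) ^ s := by
    rw [← (ZMod.chineseRemainder hcop).injective.eq_iff, Prod.ext_iff]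
    simp [hhp', hhq', pow_add]
  constructor
  · rintro ⟨s, -, hs⟩
    obtain ⟨h1, h2⟩ := (split s).1 hs
    rw [h1, h2, hα.map_pow, hγ.map_pow]
    push_cast
    ring
  · intro hi'
    obtain ⟨a, -, ha⟩ := exists_pow_eq_of_isPrimitiveRoot hgp hup
    obtain ⟨b, -, hb⟩ := exists_pow_eq_of_isPrimitiveRoot hgq huq
    rw [← ha, ← hb, hα.map_pow, hγ.map_pow] at hi'
    have hp1 : 0 < p - 1 := Nat.sub_pos_of_lt (Fact.out : p.Prime).one_lt
    have hq1 : 0 < q - 1 := Nat.sub_pos_of_lt (Fact.out : q.Prime).one_lt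
    have hp4 : 4 ∣ p - 1 := hgcd ▸ Nat.gcd_dvd_left _ _
    have hle : 4 ≤ p - 1 := Nat.le_of_dvd hp1 hp4
    -- the summand `p - 1` only serves to keep the subtraction from truncating
    have hmod : a + (p - 1) - i ≡ b [MOD Nat.gcd (p - 1) (q - 1)] := by
      rw [hgcd, ← ZMod.natCast_eq_natCast_iff, Nat.cast_sub (by omega), Nat.cast_add,
        (ZMod.natCast_eq_zero_iff _ _).2 hp4]
      linear_combination hi'
    have hlt := Nat.chineseRemainder'_lt_lcm hmod hp1.ne' hq1.ne'
    obtain ⟨hs1, hs2⟩ := (Nat.chineseRemainder' hmod).2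
    refine ⟨Nat.chineseRemainder' hmod, ?_, (split _).2 ⟨?_, ?_⟩⟩
    · rwa [Nat.lcm, hgcd] at hlt
    · rw [← ha, pow_eq_pow_iff_of_isPrimitiveRoot hgp]
      have := (hs1.add_right i).symm
      rw [Nat.sub_add_cancel (by omega)] at this
      exact (Nat.add_modEq_right (a := a)).symm.trans this
    · rw [← hb, pow_eq_pow_iff_of_isPrimitiveRoot hgq]
      exact hs2.symm

theorem seq_eq_pairSeq (hpq : p ≠ q) (hgcd : Nat.gcd (p - 1) (q - 1) = 4)
    (hgp : IsPrimitiveRoot (g : ZMod p) (p - 1)) (hgq : IsPrimitiveRoot (g : ZMod q) (q - 1))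
    (hhp : h ≡ g [ZMOD p]) (hhq : h ≡ 1 [ZMOD q])
    (hα : IsQuarticLog (g : ZMod p) α) (hγ : IsQuarticLog (g : ZMod q) γ) (u : ℕ) :
    seq p q g h u = pairSeq α γ (u : ZMod p) (u : ZMod q) := by
  have hp : 0 < p := (Fact.out : p.Prime).pos
  have hq : 0 < q := (Fact.out : q.Prime).pos
  unfold seq pairSeq
  simp only [ZMod.natCast_eq_zero_iff, natCast_mem_classQ_union_zero_iff hp]
  by_cases huq : q ∣ u
  · simp only [huq, if_true]
  simp only [huq, if_false, natCast_mem_classP_iff hq huq]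
  by_cases hup : p ∣ u
  · simp only [hup, if_true]
  simp only [hup, if_false]
  have huq' := mt (ZMod.natCast_eq_zero_iff u q).1 huq
  have hup' := mt (ZMod.natCast_eq_zero_iff u p).1 hup
  have hmem {i : ℕ} (hi : i < 4) := natCast_mem_cyclotomicClass_iff hpq hgcd hgp hgq hhp hhq
    hα hγ hup' huq' hi
  rw [hmem (i := 0) (by norm_num), hmem (i := 1) (by norm_num), hmem (i := 2) (by norm_num)]
  have key : ∀ c : ZMod 4, c ≠ (0 : ℕ) → c ≠ (1 : ℕ) → c ≠ (2 : ℕ) → 3 = c := by decide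
  split_ifs with h0 h1 h2
  · exact_mod_cast h0.symm
  · exact_mod_cast h1.symm
  · exact_mod_cast h2.symm
  · exact key _ h0 h1 h2

end Sequence

/-! ### The transform of the sequence -/

section LogSum

variable {R : Type*} [CommRing R]

theorem natCast_eq_one_of_four_dvd_sub_one (f : ZMod 4 →+* R) {p : ℕ} (hp : 0 < p)
    (hp4 : 4 ∣ p - 1) : (p : R) = 1 := by
  have h : (p : ZMod 4) = 1 := by
    rw [← Nat.sub_add_cancel hp, Nat.cast_add, (ZMod.natCast_eq_zero_iff _ _).2 hp4]
    simp
  rw [← map_natCast f, h, map_one]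

variable {p q : ℕ} [Fact p.Prime] [Fact q.Prime]

/-- The logarithmic analogue of a Gauss sum: the transform of a discrete logarithm. -/
def logSum (f : ZMod 4 →+* R) (α : ZMod p → ZMod 4) (η : AddChar (ZMod p) R) (c : ZMod p) : R :=
  ∑ a, f (α a) * η (c * a)

theorem sum_erase_zero_addChar_mul (f : ZMod 4 →+* R) {η : AddChar (ZMod p) R}
    (hη : ∀ x, x ≠ 0 → IsUnit (η x - 1)) (hp4 : 4 ∣ p - 1) (c : ZMod p) :
    ∑ a ∈ Finset.univ.erase 0, η (c * a) = (if c = 0 then 1 else 0) - 1 := by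
  have h := Finset.add_sum_erase Finset.univ (fun a => η (c * a)) (Finset.mem_univ 0)
  rw [sum_addChar_mul hη, natCast_eq_one_of_four_dvd_sub_one f (Fact.out : p.Prime).pos hp4,
    mul_zero, AddChar.map_zero_eq_one] at h
  linear_combination h

/-- A discrete logarithm is additive, so that its transform at `c ≠ 0` is its transform at `1`,
shifted by the logarithm of `c`. -/
theorem logSum_eq_add (f : ZMod 4 →+* R) {g : ZMod p} {α : ZMod p → ZMod 4} (hα : IsQuarticLog g α)
    (hg : IsPrimitiveRoot g (p - 1)) {η : AddChar (ZMod p) R}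
    (hη : ∀ x, x ≠ 0 → IsUnit (η x - 1)) (hp4 : 4 ∣ p - 1) {c : ZMod p} (hc : c ≠ 0) :
    logSum f α η c = logSum f α η 1 + f (α c) := by
  have erase (d : ZMod p) : logSum f α η d =
      ∑ a ∈ Finset.univ.erase 0, f (α a) * η (d * a) := by
    rw [logSum, ← Finset.add_sum_erase _ _ (Finset.mem_univ 0), hα.map_zero, map_zero, zero_mul,
      zero_add]
  have hone : logSum f α η 1 = ∑ a ∈ Finset.univ.erase 0, f (α (c * a)) * η (c * a) := by
    rw [logSum, ← Equiv.sum_comp (Equiv.mulLeft₀ c hc),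
      ← Finset.add_sum_erase _ _ (Finset.mem_univ 0)]
    simp [hα.map_zero]
  have hsum := sum_erase_zero_addChar_mul f hη hp4 c
  rw [if_neg hc] at hsum
  have h : ∑ a ∈ Finset.univ.erase 0, f (α (c * a)) * η (c * a) =
      f (α c) * ∑ a ∈ Finset.univ.erase 0, η (c * a) +
        ∑ a ∈ Finset.univ.erase 0, f (α a) * η (c * a) := by
    rw [Finset.mul_sum, ← Finset.sum_add_distrib]
    refine Finset.sum_congr rfl fun a ha => ?_
    rw [hα.map_mul hg hc (Finset.ne_of_mem_erase ha), map_add, add_mul]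
  rw [hone, h, hsum, erase]
  ring

/-- Each of `0`, `1`, `2`, `3`, which add up to `2` modulo `4`, is the logarithm of `(p - 1) / 4`
residues. -/
theorem logSum_zero (f : ZMod 4 →+* R) {g : ZMod p} {α : ZMod p → ZMod 4} (hα : IsQuarticLog g α)
    (hg : IsPrimitiveRoot g (p - 1)) (η : AddChar (ZMod p) R) (hp4 : 4 ∣ p - 1) :
    logSum f α η 0 = f (2 * ((p - 1) / 4 : ℕ)) := by
  have h := hα.sum_comp hp4 hg fun m => f m
  have h6 : ∑ m : ZMod 4, f m = f 2 := by
    rw [← map_sum]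
    exact congrArg f (by decide)
  rw [logSum, ← Finset.add_sum_erase _ _ (Finset.mem_univ 0), hα.map_zero]
  simp only [zero_mul, map_zero, AddChar.map_zero_eq_one, mul_one, zero_add]
  rw [h, h6, nsmul_eq_mul, map_mul, map_natCast, mul_comm]

/-- The values of `pairSeq` are combinations of products of functions of one variable, so that the
transform on pairs reduces to one-variable transforms. -/
theorem sum_pairSeq_mul_addChar (f : ZMod 4 →+* R) {α : ZMod p → ZMod 4} {γ : ZMod q → ZMod 4}
    (hα : α 0 = 0) (hγ : γ 0 = 0) {η : AddChar (ZMod p) R} {θ : AddChar (ZMod q) R}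
    (hη : ∀ x, x ≠ 0 → IsUnit (η x - 1)) (hθ : ∀ x, x ≠ 0 → IsUnit (θ x - 1))
    (hp4 : 4 ∣ p - 1) (hq4 : 4 ∣ q - 1) (c : ZMod p) (d : ZMod q) :
    ∑ a, ∑ b, f (pairSeq α γ a b) * (η (c * a) * θ (d * b)) =
      2 * (if c = 0 then 1 else 0) + logSum f α η c * ((if d = 0 then 1 else 0) - 1) -
        ((if c = 0 then 1 else 0) - 1) * logSum f γ θ d := by
  have inner (a : ZMod p) : ∑ b, f (pairSeq α γ a b) * (η (c * a) * θ (d * b)) =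
      2 * η (c * a) + f (α a) * η (c * a) * ((if d = 0 then 1 else 0) - 1) -
        (if a = 0 then 0 else η (c * a)) * logSum f γ θ d := by
    have hγsum : logSum f γ θ d = ∑ b ∈ Finset.univ.erase 0, f (γ b) * θ (d * b) := by
      rw [logSum, ← Finset.add_sum_erase _ _ (Finset.mem_univ 0), hγ, map_zero, zero_mul,
        zero_add]
    rw [← Finset.add_sum_erase _ _ (Finset.mem_univ 0), hγsum,
      ← sum_erase_zero_addChar_mul f hθ hq4, Finset.mul_sum, Finset.mul_sum, add_sub_assoc,
      ← Finset.sum_sub_distrib]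
    congr 1
    · simp [pairSeq, map_ofNat f 2]
    · refine Finset.sum_congr rfl fun b hb => ?_
      rw [pairSeq, if_neg (Finset.ne_of_mem_erase hb)]
      split_ifs with ha
      · rw [ha, hα, map_zero]
        ring
      · rw [map_sub]
        ring
  simp only [inner]
  rw [Finset.sum_sub_distrib, Finset.sum_add_distrib, ← Finset.mul_sum, ← Finset.sum_mul,
    ← Finset.sum_mul, sum_addChar_mul hη,
    natCast_eq_one_of_four_dvd_sub_one f (Fact.out : p.Prime).pos hp4,
    ← sum_erase_zero_addChar_mul f hη hp4 c]
  congr 2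
  rw [← Finset.add_sum_erase _ _ (Finset.mem_univ 0), if_pos rfl, zero_add]
  exact Finset.sum_congr rfl fun a ha => if_neg (Finset.ne_of_mem_erase ha)

end LogSum

section Count

variable {p q : ℕ} [Fact p.Prime] [Fact q.Prime]

theorem sum_pairs_eq {M : Type*} [AddCommMonoid M] (F : ZMod p × ZMod q → M) :
    ∑ x, F x = F (0, 0) + ∑ d ∈ Finset.univ.erase 0, F (0, d) +
      ∑ c ∈ Finset.univ.erase 0, F (c, 0) +
      ∑ d ∈ Finset.univ.erase 0, ∑ c ∈ Finset.univ.erase 0, F (c, d) := by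
  rw [Fintype.sum_prod_type_right, ← Finset.add_sum_erase _ _ (Finset.mem_univ 0),
    ← Finset.add_sum_erase _ _ (Finset.mem_univ (0 : ZMod p)), Finset.sum_congr rfl fun d _ =>
    (Finset.add_sum_erase _ (fun c => F (c, d)) (Finset.mem_univ (0 : ZMod p))).symm,
    Finset.sum_add_distrib]
  abel

/-- As `c` and `d` run over the nonzero residues, the differences of their logarithms miss a given
element of a larger ring either never or for exactly a quarter of the pairs. -/
theorem sum_sum_ite_log_sub {g : ZMod p} {α : ZMod p → ZMod 4}
    (γ : ZMod q → ZMod 4) (hα : IsQuarticLog g α) (hg : IsPrimitiveRoot g (p - 1))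
    (hp4 : 4 ∣ p - 1) {R : Type*} [CommRing R] {f : ZMod 4 →+* R}
    (hf : Function.Injective f) (K : R) [DecidableEq R] :
    (∑ d ∈ Finset.univ.erase (0 : ZMod q), ∑ c ∈ Finset.univ.erase (0 : ZMod p),
        (if K - f (α c) + f (γ d) = 0 then 0 else 1)) = (p - 1) * (q - 1) ∨
    (∑ d ∈ Finset.univ.erase (0 : ZMod q), ∑ c ∈ Finset.univ.erase (0 : ZMod p),
        (if K - f (α c) + f (γ d) = 0 then 0 else 1)) =
      (p - 1) * (q - 1) - (p - 1) * (q - 1) / 4 := by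
  have hcard (r : ℕ) [Fact r.Prime] : (Finset.univ.erase (0 : ZMod r)).card = r - 1 := by
    rw [Finset.card_erase_of_mem (Finset.mem_univ _), Finset.card_univ, ZMod.card]
  by_cases hK : ∃ k, f k = K
  · right
    obtain ⟨k, rfl⟩ := hK
    have hinner (d : ZMod q) : ∑ c ∈ Finset.univ.erase (0 : ZMod p),
        (if f k - f (α c) + f (γ d) = 0 then 0 else 1) = (p - 1) / 4 * 3 := by
      have h := hα.sum_comp hp4 hg fun m => if f k - f m + f (γ d) = 0 then 0 else 1
      rw [h, smul_eq_mul]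
      congr 1
      simp only [← map_sub, ← map_add, map_eq_zero_iff f hf]
      generalize γ d = m
      clear h
      revert k m
      decide
    simp only [hinner, Finset.sum_const, hcard, smul_eq_mul]
    obtain ⟨m, hm⟩ := hp4
    rw [hm, Nat.mul_div_cancel_left _ (by norm_num), mul_assoc 4 m,
      Nat.mul_div_cancel_left _ (by norm_num)]
    have : (q - 1) * (m * 3) = 3 * (m * (q - 1)) := by ring
    omega
  · left
    have hne (c : ZMod p) (d : ZMod q) : K - f (α c) + f (γ d) ≠ 0 := by
      intro h
      refine hK ⟨α c - γ d, ?_⟩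
      rw [map_sub]
      linear_combination -h
    simp only [hne, if_false, Finset.sum_const, hcard, smul_eq_mul]
    ring

end Count

section Spectrum

variable {p q : ℕ} [Fact p.Prime] [Fact q.Prime] {R k : Type*} [CommRing R] [Field k]

/-- The sequence as a function on `ℤ/pq`. -/
def periodSeq (hcop : p.Coprime q) (α : ZMod p → ZMod 4) (γ : ZMod q → ZMod 4)
    (x : ZMod (p * q)) : ZMod 4 :=
  pairSeq α γ (ZMod.chineseRemainder hcop x).1 (ZMod.chineseRemainder hcop x).2

theorem exists_dft_periodSeq_eq (D : GaloisRing (p * q) R k) (hcop : p.Coprime q)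
    {α : ZMod p → ZMod 4} {γ : ZMod q → ZMod 4} (hα : α 0 = 0) (hγ : γ 0 = 0)
    (hp4 : 4 ∣ p - 1) (hq4 : 4 ∣ q - 1) :
    ∃ (η : AddChar (ZMod p) R) (θ : AddChar (ZMod q) R),
      (∀ x, x ≠ 0 → IsUnit (η x - 1)) ∧ (∀ x, x ≠ 0 → IsUnit (θ x - 1)) ∧
      ∀ c d, D.dft (periodSeq hcop α γ) ((ZMod.chineseRemainder hcop).symm (c, d)) =
        2 * (if c = 0 then 1 else 0) + logSum D.base α η c * ((if d = 0 then 1 else 0) - 1) -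
          ((if c = 0 then 1 else 0) - 1) * logSum D.base γ θ d := by
  set e := ZMod.chineseRemainder hcop
  let η : AddChar (ZMod p) R :=
    D.char.compAddMonoidHom (e.symm.toAddMonoidHom.comp (AddMonoidHom.inl _ _))
  let θ : AddChar (ZMod q) R :=
    D.char.compAddMonoidHom (e.symm.toAddMonoidHom.comp (AddMonoidHom.inr _ _))
  have hη : ∀ x, x ≠ 0 → IsUnit (η x - 1) := fun x hx =>
    D.isUnit_char_sub_one (x := e.symm (x, 0)) (by simpa using hx)
  have hθ : ∀ x, x ≠ 0 → IsUnit (θ x - 1) := fun x hx =>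
    D.isUnit_char_sub_one (x := e.symm (0, x)) (by simpa using hx)
  refine ⟨η, θ, hη, hθ, fun c d => ?_⟩
  rw [← sum_pairSeq_mul_addChar D.base hα hγ hη hθ hp4 hq4, GaloisRing.dft,
    ← e.symm.toEquiv.sum_comp, Fintype.sum_prod_type]
  refine Finset.sum_congr rfl fun a _ => Finset.sum_congr rfl fun b _ => ?_
  have hs : periodSeq hcop α γ (e.symm (a, b)) = pairSeq α γ a b := by
    simp [periodSeq, e]
  have hψ : D.char (e.symm (c, d) * e.symm (a, b)) = η (c * a) * θ (d * b) := by
    rw [← map_mul]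
    change _ = D.char (e.symm (c * a, 0)) * D.char (e.symm (0, d * b))
    rw [← AddChar.map_add_eq_mul, ← map_add]
    simp
  rw [← hψ, ← hs]
  rfl

/-- The number of nonzero Fourier coefficients. The frequency `0`, the multiples of `p` and those
of `q` contribute according to the parity of `(p - 1) / 4` and of `(q - 1) / 4`. -/
theorem card_spectrum_periodSeq (D : GaloisRing (p * q) R k) (hcop : p.Coprime q)
    {α : ZMod p → ZMod 4} {γ : ZMod q → ZMod 4} {g : ZMod p} {g' : ZMod q}
    (hα : IsQuarticLog g α) (hγ : IsQuarticLog g' γ)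
    (hg : IsPrimitiveRoot g (p - 1)) (hg' : IsPrimitiveRoot g' (q - 1))
    (hp4 : 4 ∣ p - 1) (hq4 : 4 ∣ q - 1) :
    ∃ M, (M = (p - 1) * (q - 1) ∨ M = (p - 1) * (q - 1) - (p - 1) * (q - 1) / 4) ∧
      (D.spectrum (periodSeq hcop α γ)).card =
        1 + (if Even ((p - 1) / 4) then q - 1 else 0) +
          (if Even ((q - 1) / 4) then 0 else p - 1) + M := by
  classical
  obtain ⟨η, θ, hη, hθ, hT⟩ := exists_dft_periodSeq_eq D hcop hα.map_zero hγ.map_zero hp4 hq4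
  have hcard (r : ℕ) [Fact r.Prime] : (Finset.univ.erase (0 : ZMod r)).card = r - 1 := by
    rw [Finset.card_erase_of_mem (Finset.mem_univ _), Finset.card_univ, ZMod.card]
  have hcast (m : ℕ) : (2 * m : ZMod 4) = if Even m then 0 else 2 := by
    have h4 : (4 : ZMod 4) = 0 := by decide
    split_ifs with hm
    · obtain ⟨n, rfl⟩ := hm
      push_cast
      linear_combination n * h4
    · obtain ⟨n, rfl⟩ := Nat.not_even_iff_odd.1 hm
      push_cast
      linear_combination n * h4
  have h20 : (2 : ZMod 4) ≠ 0 := by decide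
  have h2 : (2 : R) ≠ 0 := by
    rw [← map_ofNat D.base 2]
    exact (map_ne_zero_iff _ D.base_injective).2 h20
  have hzero : D.dft (periodSeq hcop α γ) ((ZMod.chineseRemainder hcop).symm (0, 0)) ≠ 0 := by
    simpa [hT] using h2
  have hleft {d : ZMod q} (hd : d ≠ 0) :
      D.dft (periodSeq hcop α γ) ((ZMod.chineseRemainder hcop).symm (0, d)) ≠ 0 ↔
        Even ((p - 1) / 4) := by
    have h : D.dft (periodSeq hcop α γ) ((ZMod.chineseRemainder hcop).symm (0, d)) =
        D.base (2 - if Even ((p - 1) / 4) then 0 else 2) := by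
      rw [hT, if_pos rfl, if_neg hd, logSum_zero _ hα hg _ hp4, hcast, map_sub, map_ofNat]
      ring
    rw [h, map_ne_zero_iff _ D.base_injective]
    split_ifs with hm <;> simp [hm, h20]
  have hright {c : ZMod p} (hc : c ≠ 0) :
      D.dft (periodSeq hcop α γ) ((ZMod.chineseRemainder hcop).symm (c, 0)) ≠ 0 ↔
        ¬ Even ((q - 1) / 4) := by
    have h : D.dft (periodSeq hcop α γ) ((ZMod.chineseRemainder hcop).symm (c, 0)) =
        D.base (if Even ((q - 1) / 4) then 0 else 2) := by
      rw [hT, if_pos rfl, if_neg hc, logSum_zero _ hγ hg' _ hq4, hcast]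
      ring
    rw [h, map_ne_zero_iff _ D.base_injective]
    split_ifs with hm <;> simp [hm, h20]
  refine ⟨_, sum_sum_ite_log_sub γ hα hg hp4 D.base_injective
    (logSum D.base γ θ 1 - logSum D.base α η 1), ?_⟩
  rw [GaloisRing.spectrum, Finset.card_filter,
    ← (ZMod.chineseRemainder hcop).symm.toEquiv.sum_comp, sum_pairs_eq]
  refine congrArg₂ _ (congrArg₂ _ (congrArg₂ _ (if_pos hzero) ?_) ?_) ?_
  · refine (Finset.sum_congr rfl fun d hd =>
      if_congr (hleft (Finset.ne_of_mem_erase hd)) rfl rfl).trans ?_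
    simp [hcard]
  · refine (Finset.sum_congr rfl fun c hc =>
      if_congr (hright (Finset.ne_of_mem_erase hc)) rfl rfl).trans ?_
    simp only [ite_not, Finset.sum_const, hcard, smul_eq_mul, mul_ite, mul_zero, mul_one]
  · refine Finset.sum_congr rfl fun d hd => Finset.sum_congr rfl fun c hc => ?_
    have h : D.dft (periodSeq hcop α γ) ((ZMod.chineseRemainder hcop).symm (c, d)) =
        logSum D.base γ θ 1 - logSum D.base α η 1 - D.base (α c) + D.base (γ d) := by
      rw [hT, logSum_eq_add _ hα hg hη hp4 (Finset.ne_of_mem_erase hc),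
        logSum_eq_add _ hγ hg' hθ hq4 (Finset.ne_of_mem_erase hd),
        if_neg (Finset.ne_of_mem_erase hc), if_neg (Finset.ne_of_mem_erase hd)]
      ring
    rw [← h]
    exact (if_congr Iff.rfl rfl rfl).trans (ite_not _ _ _)

end Spectrum

/-! ### The linear complexity -/

theorem linearComplexity_seq {p q : ℕ} (hp : p.Prime) (hq : q.Prime) (hpq : p ≠ q)
    (hgcd : Nat.gcd (p - 1) (q - 1) = 4) {g h : ℤ}
    (hgp : IsPrimitiveRoot (g : ZMod p) (p - 1)) (hgq : IsPrimitiveRoot (g : ZMod q) (q - 1))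
    (hhp : h ≡ g [ZMOD p]) (hhq : h ≡ 1 [ZMOD q]) :
    ∃ M, (M = (p - 1) * (q - 1) ∨ M = (p - 1) * (q - 1) - (p - 1) * (q - 1) / 4) ∧
      linearComplexity (seq p q g h) = 1 + (if Even ((p - 1) / 4) then q - 1 else 0) +
        (if Even ((q - 1) / 4) then 0 else p - 1) + M := by
  have : Fact p.Prime := ⟨hp⟩
  have : Fact q.Prime := ⟨hq⟩
  have hp4 : 4 ∣ p - 1 := hgcd ▸ Nat.gcd_dvd_left _ _
  have hq4 : 4 ∣ q - 1 := hgcd ▸ Nat.gcd_dvd_right _ _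
  have hp0 := hp.pos
  have hq0 := hq.pos
  have hodd : Odd (p * q) := by
    refine Nat.odd_mul.2 ⟨?_, ?_⟩ <;> rw [Nat.odd_iff] <;> omega
  have hcop : p.Coprime q := (Nat.coprime_primes hp hq).2 hpq
  obtain ⟨α, hα⟩ := exists_isQuarticLog hp4 hgp
  obtain ⟨γ, hγ⟩ := exists_isQuarticLog hq4 hgq
  obtain ⟨R, k, _, _, ⟨D⟩⟩ := exists_galoisRing hodd
  obtain ⟨M, hM, hcard⟩ := card_spectrum_periodSeq D hcop hα hγ hgp hgq hp4 hq4
  refine ⟨M, hM, ?_⟩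
  have hseq : seq p q g h = fun u : ℕ => periodSeq hcop α γ (u : ZMod (p * q)) := by
    funext u
    rw [seq_eq_pairSeq hpq hgcd hgp hgq hhp hhq hα hγ, periodSeq, map_natCast]
    rfl
  rw [hseq, D.linearComplexity_eq_card_spectrum hodd, hcard]

end QuaternarySequence

theorem mainTheorem4 (p q : ℕ) (hp : p.Prime) (hq : q.Prime) (hpq : p ≠ q)
    (hgcd : Nat.gcd (p - 1) (q - 1) = 4)
    (g h : ℤ)
    (hgp : IsPrimitiveRoot (g : ZMod p) (p - 1))
    (hgq : IsPrimitiveRoot (g : ZMod q) (q - 1))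
    (hhp : h ≡ g [ZMOD p]) (hhq : h ≡ 1 [ZMOD q]) :
    (p ≡ 5 [MOD 8] → q ≡ 5 [MOD 8] →
      QuaternarySequence.linearComplexity (QuaternarySequence.seq p q g h)
          = p + (p - 1) * (q - 1) ∨
      QuaternarySequence.linearComplexity (QuaternarySequence.seq p q g h)
          = p + (p - 1) * (q - 1) - (p - 1) * (q - 1) / 4) ∧
    (p ≡ 1 [MOD 8] → q ≡ 5 [MOD 8] →
      QuaternarySequence.linearComplexity (QuaternarySequence.seq p q g h)
          = p + q - 1 + (p - 1) * (q - 1) ∨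
      QuaternarySequence.linearComplexity (QuaternarySequence.seq p q g h)
          = p + q - 1 + (p - 1) * (q - 1) - (p - 1) * (q - 1) / 4) ∧
    (p ≡ 5 [MOD 8] → q ≡ 1 [MOD 8] →
      QuaternarySequence.linearComplexity (QuaternarySequence.seq p q g h)
          = 1 + (p - 1) * (q - 1) ∨
      QuaternarySequence.linearComplexity (QuaternarySequence.seq p q g h)
          = 1 + (p - 1) * (q - 1) - (p - 1) * (q - 1) / 4) := by
  have hp1 := hp.one_lt
  have hq1 := hq.one_lt
  obtain ⟨M, hM, hL⟩ :=
    QuaternarySequence.linearComplexity_seq hp hq hpq hgcd hgp hgq hhp hhq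
  have hW := Nat.div_le_self ((p - 1) * (q - 1)) 4
  simp only [Nat.ModEq]
  generalize (p - 1) * (q - 1) = W at hM hW ⊢
  split_ifs at hL with hp8 hq8 hq8 <;> rw [Nat.even_iff] at hp8 hq8 <;>
    refine ⟨fun h1 h2 => ?_, fun h1 h2 => ?_, fun h1 h2 => ?_⟩ <;> omega
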